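/- Let $n\ge 0$, let $\Omega\subset\mathbb C^n$ be an open set (not necessarily connected or bounded), and let $F\subset\partial\Omega$ be a closed set. Assume that: 1. $\partial\Omega$ is $\mathcal C^2$-smooth near $F$, i.e. every $a\in F$ has an open neighbourhood $U$ on which there is a real-valued function $\rho\in\mathcal C^2(U)$ with $d\rho\ne 0$ at every point of $U$ and $\Omega\cap U=\{z\in U:\rho(z)<0\}$; 2. $\partial\Omega\setminus F$ is locally pseudoconvex, i.e. for every $\zeta\in\partial\Omega\setminus F$ there is $r>0$ such that $B(\zeta,r)\cap\Omega$ is pseudoconvex, where $B(\zeta,r)$ is the open Euclidean ball; 3. $F$ has empty interior relative to $\partial\Omega$. Then $\Omega$ is pseudoconvex. Here an open set $D\subset\mathbb C^n$ is called pseudoconvex if there is a continuous plurisubharmonic function $u:D\to\mathbb R$ such that $\{z\in D: u(z)\le c\}$ is compact for every $c\in\mathbb R$. -/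

import Mathlib

open Set Topology

/-- A real-valued function `u` is continuous and plurisubharmonic on the open set `Ω ⊆ ℂⁿ`: it is
continuous there and satisfies the sub-mean value inequality on every closed affine complex disc
`{z + ζ w : |ζ| ≤ 1}` contained in `Ω` (`circleAverage` is the mean over the circle `|ζ| = 1`). -/
def ContinuousPlurisubharmonicOn {n : ℕ} (u : EuclideanSpace ℂ (Fin n) → ℝ)
    (Ω : Set (EuclideanSpace ℂ (Fin n))) : Prop :=
  ContinuousOn u Ω ∧
    ∀ z w : EuclideanSpace ℂ (Fin n),
      (∀ ζ : ℂ, ‖ζ‖ ≤ 1 → z + ζ • w ∈ Ω) →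
        u z ≤ Real.circleAverage (fun ζ : ℂ => u (z + ζ • w)) 0 1

/-- `Ω ⊆ ℂⁿ` is a pseudoconvex open set (not necessarily connected or bounded): it is open and
carries a continuous plurisubharmonic exhaustion function. -/
def IsPseudoconvex {n : ℕ} (Ω : Set (EuclideanSpace ℂ (Fin n))) : Prop :=
  IsOpen Ω ∧
    ∃ u : EuclideanSpace ℂ (Fin n) → ℝ, ContinuousPlurisubharmonicOn u Ω ∧
      ∀ c : ℝ, IsCompact {z | z ∈ Ω ∧ u z ≤ c}

/-- The boundary of `Ω` is locally pseudoconvex at the point `ζ`: the part of `Ω` in some Euclidean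
ball around `ζ` is pseudoconvex. -/
def LocallyPseudoconvexAt {n : ℕ} (Ω : Set (EuclideanSpace ℂ (Fin n)))
    (ζ : EuclideanSpace ℂ (Fin n)) : Prop :=
  ∃ r : ℝ, 0 < r ∧ IsPseudoconvex (Metric.ball ζ r ∩ Ω)

/-- The boundary of `Ω` is `C²`-smooth near the boundary point `a`: on an open neighbourhood `U` of
`a` there is a real `C²` defining function `ρ` of `Ω` whose (real) differential has no zero. -/
def HasC2BoundaryNear {n : ℕ} (Ω : Set (EuclideanSpace ℂ (Fin n)))
    (a : EuclideanSpace ℂ (Fin n)) : Prop :=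
  ∃ (U : Set (EuclideanSpace ℂ (Fin n))) (ρ : EuclideanSpace ℂ (Fin n) → ℝ),
    IsOpen U ∧ a ∈ U ∧ ContDiffOn ℝ 2 ρ U ∧ (∀ z ∈ U, fderiv ℝ ρ z ≠ 0) ∧
      Ω ∩ U = {z | z ∈ U ∧ ρ z < 0}

/-!
If `Ω` is not pseudoconvex, then `-log dist(·, ∂Ω)` fails to be plurisubharmonic, and at a point of
failure it is strictly touched from above along a complex line by a harmonic function. Moving this
line by a holomorphic displacement of length at most the distance to the boundary yields an entire
disc `φ` which touches `∂Ω` at a single point `p = φ 0`, with `dist(φ τ, ∂Ω) ≥ c |τ|²`, and which is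
the limit of discs inside `Ω`.

If `p ∉ F`, this contradicts the continuity principle near `p`. If `p ∈ F`, the quadratic room
around `φ` forces the Levi form of a `C²` defining function to be negative in some complex tangent
direction at `p`, and by continuity at all nearby boundary points. At each of these a quadratic disc
touches `∂Ω` from inside, so none of them is locally pseudoconvex; hence `F` contains a relative
neighbourhood of `p` in `∂Ω`, contradicting the empty interior.
-/

open Filter Metric
open scoped ComplexConjugate

section OneVariable

theorem exists_entire_quadratic_expansion {E : Type*} [NormedAddCommGroup E] [NormedSpace ℂ E]
    [CompleteSpace E] {φ : ℂ → E} (hφ : Differentiable ℂ φ) (a : ℂ) :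
    ∃ ψ : ℂ → E, Differentiable ℂ ψ ∧
      ∀ τ, φ (a + τ) = φ a + τ • deriv φ a + τ ^ 2 • ψ τ := by
  have dslope_entire : ∀ f : ℂ → E, Differentiable ℂ f → Differentiable ℂ (dslope f a) := by
    intro f hf
    rw [← differentiableOn_univ] at hf ⊢
    exact (Complex.differentiableOn_dslope univ_mem).2 hf
  refine ⟨fun τ => dslope (dslope φ a) a (a + τ),
    (dslope_entire _ (dslope_entire _ hφ)).comp (differentiable_id.const_add a), fun τ => ?_⟩
  have first := sub_smul_dslope φ a (a + τ)
  have second := sub_smul_dslope (dslope φ a) a (a + τ)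
  rw [add_sub_cancel_left] at first second
  rw [dslope_same] at second
  rw [pow_two, mul_smul, second, smul_sub, first]
  abel

theorem norm_add_sq_eq_conj_mul (a τ : ℂ) :
    ‖a + τ‖ ^ 2 = ‖a‖ ^ 2 + (2 * conj a * τ).re + ‖τ‖ ^ 2 := by
  rw [norm_add_sq (𝕜 := ℂ), RCLike.inner_apply, mul_assoc, ← Complex.ofReal_ofNat,
    Complex.re_ofReal_mul, mul_comm τ]
  rfl

section CircleAverage

variable {H : ℂ → ℂ} {b : ℂ → ℝ} {c : ℂ} {R : ℝ}

theorem circleIntegrable_re_of_differentiable (hH : Differentiable ℂ H) :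
    CircleIntegrable (fun ζ => (H ζ).re) c R :=
  (Complex.continuous_re.comp hH.continuous).continuousOn.circleIntegrable'

theorem circleAverage_re_of_differentiable (hH : Differentiable ℂ H) :
    Real.circleAverage (fun ζ => (H ζ).re) c R = (H c).re := by
  have h := Complex.reCLM.circleAverage_comp_comm (f := H) (c := c) (R := R)
    hH.continuous.continuousOn.circleIntegrable'
  rwa [hH.diffContOnCl.circleAverage] at h

theorem circleAverage_le_re (hb : CircleIntegrable b c R) (hH : Differentiable ℂ H)
    (hle : ∀ ζ ∈ sphere c |R|, b ζ ≤ (H ζ).re) : Real.circleAverage b c R ≤ (H c).re :=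
  (Real.circleAverage_mono hb (circleIntegrable_re_of_differentiable hH) hle).trans_eq
    (circleAverage_re_of_differentiable hH)

theorem re_le_circleAverage (hb : CircleIntegrable b c R) (hH : Differentiable ℂ H)
    (hle : ∀ ζ ∈ sphere c |R|, (H ζ).re ≤ b ζ) : (H c).re ≤ Real.circleAverage b c R :=
  (circleAverage_re_of_differentiable hH).symm.trans_le
    (Real.circleAverage_mono (circleIntegrable_re_of_differentiable hH) hb hle)

end CircleAverage

theorem fourier_eq_circleMap_pow (m : ℕ) (θ : ℝ) :
    fourier (T := 2 * Real.pi) m θ = circleMap 0 1 θ ^ m := by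
  have hπ : (Real.pi : ℂ) ≠ 0 := Complex.ofReal_ne_zero.2 Real.pi_ne_zero
  rw [fourier_coe_apply, circleMap, Complex.ofReal_one, one_mul, zero_add, ← Complex.exp_nat_mul]
  congr 1
  push_cast
  field_simp

theorem exists_entire_re_eq_of_mem_span_fourier {P : C(AddCircle (2 * Real.pi), ℂ)}
    (hP : P ∈ Submodule.span ℂ (range (fourier (T := 2 * Real.pi)))) (c : ℂ) :
    ∃ f : ℂ → ℂ, Differentiable ℂ f ∧ ∀ θ : ℝ, (c * P θ).re = (f (circleMap 0 1 θ)).re := by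
  induction hP using Submodule.span_induction generalizing c with
  | mem P hP =>
    obtain ⟨m, rfl⟩ := hP
    obtain ⟨m, rfl | rfl⟩ := m.eq_nat_or_neg
    · exact ⟨fun z => c * z ^ m, by fun_prop, fun θ => by rw [fourier_eq_circleMap_pow]⟩
    · refine ⟨fun z => conj c * z ^ m, by fun_prop, fun θ => ?_⟩
      rw [fourier_neg, fourier_eq_circleMap_pow, ← Complex.conj_re, map_mul, Complex.conj_conj]
  | zero => exact ⟨fun _ => 0, by fun_prop, by simp⟩
  | add P Q _ _ hP hQ =>
    obtain ⟨f, hf, hPf⟩ := hP c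
    obtain ⟨g, hg, hQg⟩ := hQ c
    refine ⟨fun z => f z + g z, by fun_prop, fun θ => ?_⟩
    rw [ContinuousMap.add_apply, mul_add, Complex.add_re, Complex.add_re, hPf, hQg]
  | smul a P _ hP =>
    obtain ⟨f, hf, hPf⟩ := hP (c * a)
    refine ⟨f, hf, fun θ => ?_⟩
    rw [ContinuousMap.smul_apply, smul_eq_mul, ← mul_assoc, hPf]

theorem exists_entire_re_close_on_sphere {b : ℂ → ℝ} (hb : ContinuousOn b (sphere 0 1)) {ε : ℝ}
    (hε : 0 < ε) :
    ∃ f : ℂ → ℂ, Differentiable ℂ f ∧ ∀ ζ ∈ sphere (0 : ℂ) 1, |b ζ - (f ζ).re| < ε := by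
  have : Fact (0 < 2 * Real.pi) := ⟨Real.two_pi_pos⟩
  have hcont : Continuous fun θ : ℝ => (b (circleMap 0 1 θ) : ℂ) :=
    Complex.continuous_ofReal.comp
      (hb.comp_continuous (continuous_circleMap 0 1) fun θ => by simp)
  have hper : Function.Periodic (fun θ : ℝ => (b (circleMap 0 1 θ) : ℂ)) (2 * Real.pi) :=
    fun θ => by simp only [periodic_circleMap 0 1 θ]
  let B : C(AddCircle (2 * Real.pi), ℂ) := ⟨hper.lift, continuous_coinduced_dom.2 hcont⟩
  have hB : B ∈ (Submodule.span ℂ (range (fourier (T := 2 * Real.pi)))).topologicalClosure := by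
    rw [span_fourier_closure_eq_top]
    exact Submodule.mem_top
  obtain ⟨P, hP, hBP⟩ := Metric.mem_closure_iff.1 hB ε hε
  obtain ⟨f, hf, hPf⟩ := exists_entire_re_eq_of_mem_span_fourier hP 1
  refine ⟨f, hf, fun ζ hζ => ?_⟩
  obtain ⟨θ, -, rfl⟩ : ζ ∈ circleMap 0 1 '' Ioc 0 (2 * Real.pi) := by
    rwa [image_circleMap_Ioc, abs_one]
  have hclose : ‖(b (circleMap 0 1 θ) : ℂ) - P θ‖ < ε :=
    ((dist_eq_norm _ _).symm.trans_le (B.dist_apply_le_dist (g := P) θ)).trans_lt hBP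
  calc |b (circleMap 0 1 θ) - (f (circleMap 0 1 θ)).re|
      = |((b (circleMap 0 1 θ) : ℂ) - P θ).re| := by
        rw [← hPf, one_mul, Complex.sub_re, Complex.ofReal_re]
    _ ≤ ‖(b (circleMap 0 1 θ) : ℂ) - P θ‖ := Complex.abs_re_le_norm _
    _ < ε := hclose

theorem exists_entire_re_ge_of_circleAverage_lt {b : ℂ → ℝ} (hb : ContinuousOn b (sphere 0 1))
    {A : ℝ} (hA : Real.circleAverage b 0 1 < A) :
    ∃ f : ℂ → ℂ, Differentiable ℂ f ∧ (∀ ζ ∈ sphere (0 : ℂ) 1, b ζ ≤ (f ζ).re) ∧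
      (f 0).re < A := by
  set ε := (A - Real.circleAverage b 0 1) / 3 with hε
  have hε0 : 0 < ε := by linarith
  obtain ⟨f, hf, hclose⟩ := exists_entire_re_close_on_sphere hb hε0
  refine ⟨fun ζ => f ζ + (ε : ℝ), by fun_prop, fun ζ hζ => ?_, ?_⟩
  · rw [Complex.add_re, Complex.ofReal_re]
    linarith [(abs_lt.1 (hclose ζ hζ)).2]
  · have hmean : (f 0 - (ε : ℝ)).re ≤ Real.circleAverage b 0 1 := by
      refine re_le_circleAverage (H := fun ζ => f ζ - (ε : ℝ))
        (ContinuousOn.circleIntegrable' (by simpa using hb)) (by fun_prop) fun ζ hζ => ?_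
      rw [abs_one] at hζ
      rw [Complex.sub_re, Complex.ofReal_re]
      linarith [(abs_lt.1 (hclose ζ hζ)).1]
    rw [Complex.sub_re, Complex.ofReal_re] at hmean
    rw [Complex.add_re, Complex.ofReal_re]
    linarith

/-- Near `0` the function `v` lies below the strictly superharmonic function `Re g - ε|τ|²`, with
equality at `0`: the viscosity-sense failure of subharmonicity at `0`. -/
def IsStrictlyTouched (v : ℂ → ℝ) : Prop :=
  ∃ (g : ℂ → ℂ) (ε : ℝ), Differentiable ℂ g ∧ 0 < ε ∧ (g 0).re = v 0 ∧
    ∀ᶠ τ in 𝓝 0, v τ ≤ (g τ).re - ε * ‖τ‖ ^ 2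

theorem exists_isStrictlyTouched_of_circleAverage_lt {v : ℂ → ℝ}
    (hv : ContinuousOn v (closedBall 0 1)) (hlt : Real.circleAverage v 0 1 < v 0) :
    ∃ ζ₀ ∈ ball (0 : ℂ) 1, IsStrictlyTouched fun τ => v (ζ₀ + τ) := by
  obtain ⟨f, hf, hvf, hf0⟩ := exists_entire_re_ge_of_circleAverage_lt
    (hv.mono sphere_subset_closedBall) hlt
  set ε := (v 0 - (f 0).re) / 2 with hε
  have hε0 : 0 < ε := by linarith
  have hcont : ContinuousOn (fun ζ => v ζ - (f ζ).re + ε * ‖ζ‖ ^ 2) (closedBall 0 1) :=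
    (hv.sub (Complex.continuous_re.comp hf.continuous).continuousOn).add (by fun_prop)
  obtain ⟨ζ₀, hζ₀, hmax⟩ := (isCompact_closedBall (0 : ℂ) 1).exists_isMaxOn
    (nonempty_closedBall.2 zero_le_one) hcont
  rw [isMaxOn_iff] at hmax
  have hζ₀_lt : ζ₀ ∈ ball (0 : ℂ) 1 := by
    by_contra hge
    have hsphere : ζ₀ ∈ sphere (0 : ℂ) 1 := by
      rw [← closedBall_sdiff_ball]
      exact ⟨hζ₀, hge⟩
    have hcentre := hmax 0 (by simp)
    rw [mem_sphere_zero_iff_norm.1 hsphere, norm_zero] at hcentre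
    linarith [hvf ζ₀ hsphere]
  refine ⟨ζ₀, hζ₀_lt, fun τ => f (ζ₀ + τ) + ((v ζ₀ - (f ζ₀).re : ℝ) : ℂ) - (ε : ℝ) *
    (2 * conj ζ₀ * τ), ε, by fun_prop, hε0, ?_, ?_⟩
  · simp
  · have hnear : ∀ᶠ τ in 𝓝 (0 : ℂ), ζ₀ + τ ∈ ball (0 : ℂ) 1 :=
      (continuous_const_add ζ₀).continuousAt.eventually_mem
        (by simpa using isOpen_ball.mem_nhds hζ₀_lt)
    filter_upwards [hnear] with τ hτ
    have hτmax := hmax (ζ₀ + τ) (ball_subset_closedBall hτ)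
    rw [norm_add_sq_eq_conj_mul] at hτmax
    rw [Complex.sub_re, Complex.add_re, Complex.ofReal_re, Complex.re_ofReal_mul]
    linarith

end OneVariable

section Plurisubharmonic

variable {n : ℕ} {u v : EuclideanSpace ℂ (Fin n) → ℝ} {D : Set (EuclideanSpace ℂ (Fin n))}

theorem circleIntegrable_affine_of_continuousOn (hu : ContinuousOn u D)
    {z w : EuclideanSpace ℂ (Fin n)} (hzw : ∀ ζ : ℂ, ‖ζ‖ ≤ 1 → z + ζ • w ∈ D) :
    CircleIntegrable (fun ζ : ℂ => u (z + ζ • w)) 0 1 := by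
  refine ContinuousOn.circleIntegrable' (hu.comp (by fun_prop) fun ζ hζ => hzw ζ ?_)
  rw [abs_one, mem_sphere_zero_iff_norm] at hζ
  exact hζ.le

namespace ContinuousPlurisubharmonicOn

theorem max (hu : ContinuousPlurisubharmonicOn u D) (hv : ContinuousPlurisubharmonicOn v D) :
    ContinuousPlurisubharmonicOn (fun z => u z ⊔ v z) D := by
  have hcont : ContinuousOn (fun z => u z ⊔ v z) D := hu.1.sup hv.1
  refine ⟨hcont, fun z w hzw => sup_le ((hu.2 z w hzw).trans ?_) ((hv.2 z w hzw).trans ?_)⟩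
  · exact Real.circleAverage_mono (circleIntegrable_affine_of_continuousOn hu.1 hzw)
      (circleIntegrable_affine_of_continuousOn hcont hzw) fun _ _ => le_sup_left
  · exact Real.circleAverage_mono (circleIntegrable_affine_of_continuousOn hv.1 hzw)
      (circleIntegrable_affine_of_continuousOn hcont hzw) fun _ _ => le_sup_right

theorem norm (D : Set (EuclideanSpace ℂ (Fin n))) :
    ContinuousPlurisubharmonicOn (fun z => ‖z‖) D := by
  refine ⟨continuous_norm.continuousOn, fun z w hzw => ?_⟩
  obtain ⟨ℓ, hℓ, hℓz⟩ := exists_dual_vector'' ℂ z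
  have hmean := re_le_circleAverage (H := fun ζ => ℓ (z + ζ • w))
    (circleIntegrable_affine_of_continuousOn continuous_norm.continuousOn hzw) (by fun_prop)
    fun ζ _ => (Complex.re_le_norm _).trans ((ℓ.le_of_opNorm_le hℓ _).trans_eq (one_mul _))
  simpa [hℓz] using hmean

theorem not_isStrictlyTouched (hu : ContinuousPlurisubharmonicOn u D) (hD : IsOpen D)
    {z : EuclideanSpace ℂ (Fin n)} (hz : z ∈ D) (w : EuclideanSpace ℂ (Fin n)) :
    ¬ IsStrictlyTouched fun τ => u (z + τ • w) := by
  rintro ⟨g, ε, hg, hε, hg0, hug⟩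
  have hnear : ∀ᶠ τ : ℂ in 𝓝 0, z + τ • w ∈ D :=
    (by fun_prop : Continuous fun τ : ℂ => z + τ • w).continuousAt.eventually_mem
      (hD.mem_nhds (by simpa using hz))
  obtain ⟨r, hr, hball⟩ := nhds_basis_closedBall.eventually_iff.1 (hnear.and hug)
  have hscale : ∀ ζ : ℂ, z + ζ • (r : ℂ) • w = z + ((r : ℂ) * ζ) • w := fun ζ => by
    rw [smul_smul, mul_comm]
  have hnorm : ∀ ζ : ℂ, ‖(r : ℂ) * ζ‖ = r * ‖ζ‖ := fun ζ => by
    rw [norm_mul, Complex.norm_real, Real.norm_of_nonneg hr.le]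
  have hdisc : ∀ ζ : ℂ, ‖ζ‖ ≤ 1 → (r : ℂ) * ζ ∈ closedBall (0 : ℂ) r := fun ζ hζ => by
    rw [mem_closedBall_zero_iff, hnorm]
    exact mul_le_of_le_one_right hr.le hζ
  have hzw : ∀ ζ : ℂ, ‖ζ‖ ≤ 1 → z + ζ • (r : ℂ) • w ∈ D := fun ζ hζ => by
    rw [hscale]
    exact (hball (hdisc ζ hζ)).1
  have hmean : u z ≤ (g ((r : ℂ) * 0) - (ε * r ^ 2 : ℝ)).re := by
    refine (hu.2 z _ hzw).trans (circleAverage_le_re (H := fun ζ => g (r * ζ) - (ε * r ^ 2 : ℝ))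
      (circleIntegrable_affine_of_continuousOn hu.1 hzw) (by fun_prop) fun ζ hζ => ?_)
    rw [abs_one, mem_sphere_zero_iff_norm] at hζ
    have htouch := (hball (hdisc ζ hζ.le)).2
    rw [hnorm, hζ, mul_one] at htouch
    rwa [hscale, Complex.sub_re, Complex.ofReal_re]
  simp only [Complex.sub_re, Complex.ofReal_re, mul_zero, hg0, zero_smul, add_zero] at hmean
  have : 0 < ε * r ^ 2 := by positivity
  linarith

end ContinuousPlurisubharmonicOn

end Plurisubharmonic

section MaximumPrinciple

/-- The variable `y` decouples the point at which `u` is evaluated from the disc `φ`, and the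
penalty `k * dist (φ x) y ^ 2` keeps the two close. -/
theorem exists_isMaxOn_penalised {X Y : Type*} [TopologicalSpace X] [PseudoMetricSpace Y]
    {A : Set X} {K : Set Y} (hA : IsCompact A) (hAne : A.Nonempty) (hK : IsCompact K)
    {φ : X → Y} (hφ : ContinuousOn φ A) (hφK : MapsTo φ A K) {u : Y → ℝ} (hu : ContinuousOn u K)
    {w : X → ℝ} (hw : ContinuousOn w A) {η : ℝ} (hη : 0 < η) :
    ∃ k : ℝ, 0 ≤ k ∧ ∃ x₀ ∈ A, ∃ y₀ ∈ K, dist (φ x₀) y₀ < η ∧ u y₀ < u (φ x₀) + η ∧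
      IsMaxOn (fun p : X × Y => u p.2 + w p.1 - k * dist (φ p.1) p.2 ^ 2) (A ×ˢ K) (x₀, y₀) := by
  obtain ⟨B, hB⟩ := hK.exists_bound_of_continuousOn hu
  obtain ⟨γ, hγ, huγ⟩ := Metric.uniformContinuousOn_iff.1
    (hK.uniformContinuousOn_of_continuous hu) η hη
  have hB0 : 0 ≤ B := (norm_nonneg _).trans (hB _ (hφK hAne.some_mem))
  have : 0 < min γ η := lt_min hγ hη
  set k := (2 * B + 1) / min γ η ^ 2 with hk
  have hk0 : 0 ≤ k := by positivity
  have hcont : ContinuousOn (fun p : X × Y => u p.2 + w p.1 - k * dist (φ p.1) p.2 ^ 2)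
      (A ×ˢ K) := by
    have hu' := hu.comp continuousOn_snd (s := A ×ˢ K) fun p hp => hp.2
    have hw' := hw.comp continuousOn_fst (s := A ×ˢ K) fun p hp => hp.1
    have hφ' := hφ.comp continuousOn_fst (s := A ×ˢ K) fun p hp => hp.1
    have hdist := continuous_dist.comp_continuousOn (hφ'.prodMk continuousOn_snd)
    exact (hu'.add hw').sub ((hdist.pow 2).const_mul k)
  obtain ⟨⟨x₀, y₀⟩, ⟨hx₀, hy₀⟩, hmax⟩ := (hA.prod hK).exists_isMaxOn
    ⟨(hAne.some, φ hAne.some), hAne.some_mem, hφK hAne.some_mem⟩ hcont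
  have hclose : dist (φ x₀) y₀ < min γ η := by
    by_contra! hfar
    have hcompare := isMaxOn_iff.1 hmax (x₀, φ x₀) ⟨hx₀, hφK hx₀⟩
    rw [dist_self] at hcompare
    have hpenalty : 2 * B + 1 ≤ k * dist (φ x₀) y₀ ^ 2 := by
      calc 2 * B + 1 = k * min γ η ^ 2 := by rw [hk]; field_simp
        _ ≤ k * dist (φ x₀) y₀ ^ 2 := by gcongr
    linarith [(abs_le.1 (hB _ (hφK hx₀))).1, (abs_le.1 (hB _ hy₀)).2]
  have hclose_u := (abs_lt.1 (huγ _ hy₀ _ (hφK hx₀)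
    ((dist_comm _ _).trans_lt (hclose.trans_le (min_le_left _ _))))).2
  exact ⟨k, hk0, x₀, hx₀, y₀, hy₀, hclose.trans_le (min_le_right _ _), by linarith, hmax⟩

theorem isStrictlyTouched_of_isLocalMax_penalised {E : Type*} [NormedAddCommGroup E]
    [InnerProductSpace ℂ E] [CompleteSpace E] {u : E → ℝ} {φ : ℂ → E} (hφ : Differentiable ℂ φ)
    {k ε : ℝ} (hε : 0 < ε) {ζ₀ : ℂ} {y₀ : E}
    (hmax : IsLocalMax (fun p : ℂ × E => u p.2 + ε * ‖p.1‖ ^ 2 - k * dist (φ p.1) p.2 ^ 2)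
      (ζ₀, y₀)) :
    IsStrictlyTouched fun τ => u (y₀ + τ • deriv φ ζ₀) := by
  obtain ⟨ψ, hψ, hexp⟩ := exists_entire_quadratic_expansion hφ ζ₀
  set q := φ ζ₀ - y₀ with hq
  have hinner : Differentiable ℂ fun τ : ℂ => inner ℂ q (τ ^ 2 • ψ τ) :=
    (innerSL ℂ q).differentiable.comp (by fun_prop)
  refine ⟨fun τ => (u y₀ : ℝ) - (ε : ℝ) * (2 * conj ζ₀ * τ) +
    (2 * k : ℝ) * inner ℂ q (τ ^ 2 • ψ τ), ε / 2, by fun_prop, half_pos hε, by simp, ?_⟩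
  have hnear : Tendsto (fun τ : ℂ => (ζ₀ + τ, y₀ + τ • deriv φ ζ₀)) (𝓝 0) (𝓝 (ζ₀, y₀)) :=
    Continuous.tendsto' (by fun_prop) _ _ (by simp)
  have hsmall : ∀ᶠ τ : ℂ in 𝓝 0, k * ‖τ‖ ^ 2 * ‖ψ τ‖ ^ 2 < ε / 2 := by
    have := hψ.continuous
    exact (by fun_prop : Continuous fun τ : ℂ => k * ‖τ‖ ^ 2 * ‖ψ τ‖ ^ 2).continuousAt
      |>.eventually_lt_const (by simpa using hε)
  filter_upwards [hnear.eventually hmax, hsmall] with τ hτ hτsmall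
  have hdiff : φ (ζ₀ + τ) - (y₀ + τ • deriv φ ζ₀) = q + τ ^ 2 • ψ τ := by
    rw [hexp, hq]
    abel
  rw [dist_eq_norm, dist_eq_norm, hdiff, ← hq, norm_add_sq_eq_conj_mul, norm_add_sq (𝕜 := ℂ),
    norm_smul, norm_pow, RCLike.re_to_complex] at hτ
  rw [Complex.add_re, Complex.sub_re, Complex.ofReal_re, Complex.re_ofReal_mul,
    Complex.re_ofReal_mul]
  have hremainder : k * (‖τ‖ ^ 2 * ‖ψ τ‖) ^ 2 ≤ ε / 2 * ‖τ‖ ^ 2 := by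
    calc k * (‖τ‖ ^ 2 * ‖ψ τ‖) ^ 2 = k * ‖τ‖ ^ 2 * ‖ψ τ‖ ^ 2 * ‖τ‖ ^ 2 := by ring
      _ ≤ ε / 2 * ‖τ‖ ^ 2 := by gcongr
  linarith

theorem ContinuousPlurisubharmonicOn.le_of_le_on_sphere {n : ℕ}
    {u : EuclideanSpace ℂ (Fin n) → ℝ} {D : Set (EuclideanSpace ℂ (Fin n))}
    (hu : ContinuousPlurisubharmonicOn u D) (hD : IsOpen D)
    {φ : ℂ → EuclideanSpace ℂ (Fin n)} (hφ : Differentiable ℂ φ) {s M : ℝ}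
    (hφD : MapsTo φ (closedBall 0 s) D) (hM : ∀ ζ ∈ sphere (0 : ℂ) s, u (φ ζ) ≤ M)
    {ζ₁ : ℂ} (hζ₁ : ζ₁ ∈ closedBall 0 s) : u (φ ζ₁) ≤ M := by
  by_contra! hlt
  have himage : IsCompact (φ '' closedBall 0 s) :=
    (isCompact_closedBall 0 s).image hφ.continuous
  obtain ⟨d, hd, hdD⟩ := himage.exists_cthickening_subset_open hD hφD.image_subset
  obtain ⟨ε, hε, hεM⟩ : ∃ ε : ℝ, 0 < ε ∧ ε * (s ^ 2 + 1) = u (φ ζ₁) - M :=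
    ⟨(u (φ ζ₁) - M) / (s ^ 2 + 1), div_pos (sub_pos.2 hlt) (by positivity),
      div_mul_cancel₀ _ (by positivity)⟩
  obtain ⟨k, hk, ζ₀, hζ₀, y₀, hy₀, hdist, huy₀, hmax⟩ :=
    exists_isMaxOn_penalised (isCompact_closedBall (0 : ℂ) s) ⟨ζ₁, hζ₁⟩ himage.cthickening
      hφ.continuous.continuousOn
      (fun ζ hζ => self_subset_cthickening _ (mem_image_of_mem φ hζ)) (hu.1.mono hdD)
      (w := fun ζ => ε * ‖ζ‖ ^ 2) (by fun_prop) (lt_min hε hd)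
  have hy₀_mem : y₀ ∈ thickening d (φ '' closedBall 0 s) :=
    mem_thickening_iff.2 ⟨φ ζ₀, mem_image_of_mem φ hζ₀,
      (dist_comm _ _).trans_lt (hdist.trans_le (min_le_right _ _))⟩
  have hζ₀_mem : ζ₀ ∈ ball (0 : ℂ) s := by
    by_contra hge
    have hsphere : ζ₀ ∈ sphere (0 : ℂ) s := by
      rw [← closedBall_sdiff_ball]
      exact ⟨hζ₀, hge⟩
    have hcompare := isMaxOn_iff.1 hmax (ζ₁, φ ζ₁)
      ⟨hζ₁, self_subset_cthickening _ (mem_image_of_mem φ hζ₁)⟩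
    rw [dist_self, mem_sphere_zero_iff_norm.1 hsphere] at hcompare
    have : 0 ≤ k * dist (φ ζ₀) y₀ ^ 2 := by positivity
    have : 0 ≤ ε * ‖ζ₁‖ ^ 2 := by positivity
    linarith [hM ζ₀ hsphere, min_le_left ε d]
  have hlocal : IsLocalMax (fun p : ℂ × EuclideanSpace ℂ (Fin n) =>
      u p.2 + ε * ‖p.1‖ ^ 2 - k * dist (φ p.1) p.2 ^ 2) (ζ₀, y₀) :=
    hmax.isLocalMax <| prod_mem_nhds (closedBall_mem_nhds_of_mem hζ₀_mem)
      (mem_of_superset (isOpen_thickening.mem_nhds hy₀_mem) (thickening_subset_cthickening _ _))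
  exact hu.not_isStrictlyTouched hD (hdD hy₀) _
    (isStrictlyTouched_of_isLocalMax_penalised hφ hε hlocal)

end MaximumPrinciple

section DistanceToComplement

theorem infDist_compl_pos_iff {X : Type*} [PseudoMetricSpace X] {Ω : Set X} (hΩ : IsOpen Ω)
    (hne : Ωᶜ.Nonempty) {x : X} : 0 < infDist x Ωᶜ ↔ x ∈ Ω := by
  rw [← hΩ.isClosed_compl.notMem_iff_infDist_pos hne, notMem_compl_iff]

theorem continuousOn_neg_log_infDist_compl {X : Type*} [PseudoMetricSpace X] {Ω : Set X}
    (hΩ : IsOpen Ω) (hne : Ωᶜ.Nonempty) : ContinuousOn (fun x => -Real.log (infDist x Ωᶜ)) Ω :=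
  ((continuous_infDist_pt Ωᶜ).continuousOn.log fun _ hx =>
    ((infDist_compl_pos_iff hΩ hne).2 hx).ne').neg

theorem isPseudoconvex_of_neg_log_infDist_compl {n : ℕ} {Ω : Set (EuclideanSpace ℂ (Fin n))}
    (hΩ : IsOpen Ω) (hne : Ωᶜ.Nonempty)
    (h : ContinuousPlurisubharmonicOn (fun z => -Real.log (infDist z Ωᶜ)) Ω) :
    IsPseudoconvex Ω := by
  refine ⟨hΩ, _, h.max (.norm Ω), fun c => ?_⟩
  have hsublevel : {z | z ∈ Ω ∧ -Real.log (infDist z Ωᶜ) ⊔ ‖z‖ ≤ c} =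
      {z | Real.exp (-c) ≤ infDist z Ωᶜ} ∩ closedBall 0 c := by
    ext z
    simp only [mem_ofPred_eq, mem_inter_iff, mem_closedBall_zero_iff, sup_le_iff, neg_le]
    rw [← infDist_compl_pos_iff hΩ hne, ← and_assoc]
    refine and_congr_left fun _ => ⟨fun ⟨hpos, hz⟩ => (Real.le_log_iff_exp_le hpos).1 hz,
      fun hz => ?_⟩
    have hpos := (Real.exp_pos _).trans_le hz
    exact ⟨hpos, (Real.le_log_iff_exp_le hpos).2 hz⟩
  rw [hsublevel]
  exact (isCompact_closedBall 0 c).inter_left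
    (isClosed_le continuous_const (continuous_infDist_pt _))

theorem isPseudoconvex_univ {n : ℕ} : IsPseudoconvex (univ : Set (EuclideanSpace ℂ (Fin n))) := by
  refine ⟨isOpen_univ, _, .norm univ, fun c => ?_⟩
  simpa [closedBall, dist_zero_right] using isCompact_closedBall (0 : EuclideanSpace ℂ (Fin n)) c

theorem exists_isStrictlyTouched_of_not_isPseudoconvex {n : ℕ}
    {Ω : Set (EuclideanSpace ℂ (Fin n))} (hΩ : IsOpen Ω) (h : ¬ IsPseudoconvex Ω) :
    Ωᶜ.Nonempty ∧ ∃ z ∈ Ω, ∃ w : EuclideanSpace ℂ (Fin n),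
      IsStrictlyTouched fun τ : ℂ => -Real.log (infDist (z + τ • w) Ωᶜ) := by
  have hne : Ωᶜ.Nonempty := by
    by_contra! hempty
    exact h (compl_empty_iff.1 hempty ▸ isPseudoconvex_univ)
  refine ⟨hne, ?_⟩
  by_contra! huntouched
  have hcont := continuousOn_neg_log_infDist_compl hΩ hne
  refine h (isPseudoconvex_of_neg_log_infDist_compl hΩ hne ⟨hcont, fun z w hzw => ?_⟩)
  by_contra! hlt
  obtain ⟨ζ₀, hζ₀, htouch⟩ := exists_isStrictlyTouched_of_circleAverage_lt
    (v := fun ζ => -Real.log (infDist (z + ζ • w) Ωᶜ))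
    (hcont.comp (by fun_prop) fun ζ hζ => hzw ζ (mem_closedBall_zero_iff.1 hζ))
    (by simpa using hlt)
  refine huntouched (z + ζ₀ • w) (hzw ζ₀ (mem_ball_zero_iff.1 hζ₀).le) w ?_
  simpa only [add_smul, add_assoc] using htouch

end DistanceToComplement

section ContinuityPrinciple

/-- A continuous family `Φ t`, `t ≥ 0`, of entire discs which, near the origin of the parameter
space, lie in `D` except possibly for the point `Φ 0 0`. This is the configuration of the continuity
principle; nothing is required of the position of `Φ t τ` for `t < 0`. -/
structure IsTouchingFamily {E : Type*} [NormedAddCommGroup E] [NormedSpace ℂ E] (D : Set E)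
    (Φ : ℝ → ℂ → E) : Prop where
  continuous : Continuous fun x : ℝ × ℂ => Φ x.1 x.2
  differentiable : ∀ t, Differentiable ℂ (Φ t)
  eventually_mem : ∀ᶠ x : ℝ × ℂ in 𝓝[≠] 0, 0 ≤ x.1 → Φ x.1 x.2 ∈ D

variable {n : ℕ} {D Ω : Set (EuclideanSpace ℂ (Fin n))}
  {Φ : ℝ → ℂ → EuclideanSpace ℂ (Fin n)}

theorem IsPseudoconvex.mem_of_isTouchingFamily (hD : IsPseudoconvex D)
    (hΦ : IsTouchingFamily D Φ) : Φ 0 0 ∈ D := by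
  obtain ⟨hopen, u, hu, hex⟩ := hD
  obtain ⟨s, hs, hmem⟩ := nhds_basis_closedBall.eventually_iff.1
    (eventually_nhdsWithin_iff.1 hΦ.eventually_mem)
  replace hmem : ∀ t ∈ Icc 0 s, ∀ τ ∈ closedBall (0 : ℂ) s, (t, τ) ≠ 0 → Φ t τ ∈ D := by
    intro t ht τ hτ hne
    refine hmem ?_ hne ht.1
    rw [Prod.zero_eq_mk, ← closedBall_prod_same, Real.closedBall_eq_Icc, zero_sub, zero_add]
    exact ⟨⟨(neg_nonpos.2 hs.le).trans ht.1, ht.2⟩, hτ⟩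
  have hboundary : IsCompact ((fun x : ℝ × ℂ => Φ x.1 x.2) '' Icc 0 s ×ˢ sphere 0 s) :=
    (isCompact_Icc.prod (isCompact_sphere 0 s)).image hΦ.continuous
  have hboundaryD : (fun x : ℝ × ℂ => Φ x.1 x.2) '' Icc 0 s ×ˢ sphere 0 s ⊆ D := by
    rintro _ ⟨⟨t, τ⟩, ⟨ht, hτ⟩, rfl⟩
    exact hmem t ht τ (sphere_subset_closedBall hτ) fun h =>
      ne_of_mem_sphere hτ hs.ne' (congrArg Prod.snd h)
  obtain ⟨M, hM⟩ := hboundary.exists_bound_of_continuousOn (hu.1.mono hboundaryD)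
  have hlim : Tendsto (fun t => Φ t 0) (𝓝[>] 0) (𝓝 (Φ 0 0)) :=
    ((hΦ.continuous.comp (.prodMk_left 0)).tendsto 0).mono_left nhdsWithin_le_nhds
  refine ((hex M).isClosed.mem_of_tendsto hlim ?_).1
  filter_upwards [Ioo_mem_nhdsGT hs] with t ht
  have htD : MapsTo (Φ t) (closedBall 0 s) D := fun τ hτ =>
    hmem t (Ioo_subset_Icc_self ht) τ hτ fun h => ht.1.ne' (congrArg Prod.fst h)
  have hcentre : (0 : ℂ) ∈ closedBall 0 s := mem_closedBall_self hs.le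
  exact ⟨htD hcentre, hu.le_of_le_on_sphere hopen (hΦ.differentiable t) htD
    (fun τ hτ => (le_abs_self _).trans
      (hM _ (mem_image_of_mem _ (mk_mem_prod (Ioo_subset_Icc_self ht) hτ)))) hcentre⟩

theorem LocallyPseudoconvexAt.mem_of_isTouchingFamily (h : LocallyPseudoconvexAt Ω (Φ 0 0))
    (hΦ : IsTouchingFamily Ω Φ) : Φ 0 0 ∈ Ω := by
  obtain ⟨r, hr, hball⟩ := h
  refine (hball.mem_of_isTouchingFamily ⟨hΦ.continuous, hΦ.differentiable, ?_⟩).2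
  have hnear : ∀ᶠ x : ℝ × ℂ in 𝓝 0, Φ x.1 x.2 ∈ ball (Φ 0 0) r :=
    hΦ.continuous.continuousAt.eventually_mem (ball_mem_nhds _ hr)
  filter_upwards [nhdsWithin_le_nhds hnear, hΦ.eventually_mem] with x hx hxΩ ht
  exact ⟨hx, hxΩ ht⟩

theorem IsTouchingFamily.not_locallyPseudoconvexAt (hΦ : IsTouchingFamily Ω Φ) (hΩ : IsOpen Ω)
    (hp : Φ 0 0 ∈ frontier Ω) : ¬ LocallyPseudoconvexAt Ω (Φ 0 0) := fun h =>
  (hΩ.frontier_eq ▸ hp).2 (h.mem_of_isTouchingFamily hΦ)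

end ContinuityPrinciple

section TouchingDiscs

theorem IsStrictlyTouched.exists_norm_add_le {d : ℂ → ℝ}
    (h : IsStrictlyTouched fun τ => -Real.log (d τ)) (hd : ∀ᶠ τ in 𝓝 0, 0 < d τ) :
    ∃ (f : ℂ → ℂ) (c : ℝ), Differentiable ℂ f ∧ 0 < c ∧ ‖f 0‖ = d 0 ∧
      ∀ᶠ τ in 𝓝 0, ‖f τ‖ + c * ‖τ‖ ^ 2 ≤ d τ := by
  obtain ⟨g, ε, hg, hε, hg0, hgd⟩ := h
  set f : ℂ → ℂ := fun τ => Complex.exp (-g τ) with hf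
  have hf_norm : ∀ τ, ‖f τ‖ = Real.exp (-(g τ).re) := fun τ => by
    rw [hf, Complex.norm_exp, Complex.neg_re]
  have hf0 : 0 < ‖f 0‖ := norm_pos_iff.2 (Complex.exp_ne_zero _)
  have hf_diff : Differentiable ℂ f := by fun_prop
  have hlower : ∀ᶠ τ in 𝓝 0, ‖f 0‖ / 2 < ‖f τ‖ :=
    hf_diff.continuous.norm.continuousAt.eventually_const_lt (half_lt_self hf0)
  refine ⟨f, ‖f 0‖ / 2 * ε, hf_diff, by positivity, ?_, ?_⟩
  · rw [hf_norm, hg0, neg_neg, Real.exp_log hd.self_of_nhds]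
  · filter_upwards [hgd, hd, hlower] with τ hτ hdτ hfτ
    calc ‖f τ‖ + ‖f 0‖ / 2 * ε * ‖τ‖ ^ 2 ≤ ‖f τ‖ + ‖f τ‖ * ε * ‖τ‖ ^ 2 := by gcongr
      _ = ‖f τ‖ * (ε * ‖τ‖ ^ 2 + 1) := by ring
      _ ≤ ‖f τ‖ * Real.exp (ε * ‖τ‖ ^ 2) := by gcongr; exact Real.add_one_le_exp _
      _ = Real.exp (-(g τ).re + ε * ‖τ‖ ^ 2) := by rw [hf_norm, Real.exp_add]
      _ ≤ d τ := (Real.le_log_iff_exp_le hdτ).1 (by linarith)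

variable {E : Type*} [NormedAddCommGroup E] [NormedSpace ℂ E] {Ω : Set E}

theorem exists_isTouchingFamily_of_norm_add_le_infDist [FiniteDimensional ℂ E] (hΩ : IsOpen Ω)
    (hne : Ωᶜ.Nonempty) {z w : E} (hz : z ∈ Ω) {f : ℂ → ℂ} (hf : Differentiable ℂ f) {c : ℝ}
    (hc : 0 < c) (hf0 : ‖f 0‖ = infDist z Ωᶜ)
    (hfd : ∀ᶠ τ : ℂ in 𝓝 0, ‖f τ‖ + c * ‖τ‖ ^ 2 ≤ infDist (z + τ • w) Ωᶜ) :
    ∃ Φ : ℝ → ℂ → E, IsTouchingFamily Ω Φ ∧ Φ 0 0 ∈ frontier Ω ∧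
      ∀ᶠ τ in 𝓝 0, ball (Φ 0 τ) (c * ‖τ‖ ^ 2) ⊆ Ω := by
  have hf0_ne : f 0 ≠ 0 := norm_pos_iff.1 (hf0 ▸ (infDist_compl_pos_iff hΩ hne).2 hz)
  obtain ⟨p, hp, hzp⟩ := exists_mem_frontier_infDist_compl_eq_dist hz (nonempty_compl.1 hne)
  set a := (f 0)⁻¹ • (p - z) with ha
  have ha_norm : ‖a‖ = 1 := by
    rw [ha, norm_smul, ← dist_eq_norm, dist_comm, ← hzp, norm_inv, hf0,
      inv_mul_cancel₀ (hf0 ▸ norm_ne_zero_iff.2 hf0_ne)]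
  have hf_cont := hf.continuous
  -- Shrinking the last term, by which the disc `t = 0` reaches the nearest boundary point `p`,
  -- pushes the disc into `Ω`.
  let Φ : ℝ → ℂ → E := fun t τ => z + τ • w + ((1 - t : ℝ) * f τ) • a
  have hΦ0 : Φ 0 0 = p := by simp [Φ, ha, smul_smul, hf0_ne]
  have hΦ_near : ∀ t τ, t ≤ 1 → dist (Φ t τ) (z + τ • w) = (1 - t) * ‖f τ‖ := fun t τ ht => by
    rw [dist_eq_norm, add_sub_cancel_left, norm_smul, ha_norm, mul_one, norm_mul,
      Complex.norm_real, Real.norm_of_nonneg (sub_nonneg.2 ht)]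
  refine ⟨Φ, ⟨by fun_prop, fun t => by fun_prop, ?_⟩, hΦ0 ▸ hp, ?_⟩
  · have hτ : Tendsto (Prod.snd : ℝ × ℂ → ℂ) (𝓝 0) (𝓝 0) := continuous_snd.tendsto 0
    have ht : ∀ᶠ x : ℝ × ℂ in 𝓝 0, x.1 ≤ 1 :=
      continuous_fst.continuousAt.eventually_le_const zero_lt_one
    rw [eventually_nhdsWithin_iff]
    filter_upwards [hτ.eventually hfd, ht] with ⟨t, τ⟩ hfd ht1 hne ht0
    refine ball_infDist_compl_subset (x := z + τ • w) ?_
    rw [mem_ball, hΦ_near t τ ht1]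
    rcases eq_or_ne τ 0 with rfl | hτ0
    · have ht_pos : 0 < t := lt_of_le_of_ne ht0 fun h => hne (by simp [← h])
      have : 0 < t * ‖f 0‖ := mul_pos ht_pos (norm_pos_iff.2 hf0_ne)
      rw [norm_zero] at hfd
      linarith
    · have : 0 < c * ‖τ‖ ^ 2 := mul_pos hc (pow_pos (norm_pos_iff.2 hτ0) 2)
      have : 0 ≤ t * ‖f τ‖ := mul_nonneg ht0 (norm_nonneg _)
      linarith
  · filter_upwards [hfd] with τ hτ
    refine (ball_subset_ball' ?_).trans (ball_infDist_compl_subset (x := z + τ • w))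
    rw [hΦ_near 0 τ zero_le_one]
    linarith

theorem exists_isTouchingFamily_of_isStrictlyTouched [FiniteDimensional ℂ E] (hΩ : IsOpen Ω)
    (hne : Ωᶜ.Nonempty) {z w : E} (hz : z ∈ Ω)
    (h : IsStrictlyTouched fun τ : ℂ => -Real.log (infDist (z + τ • w) Ωᶜ)) :
    ∃ (Φ : ℝ → ℂ → E) (c : ℝ), IsTouchingFamily Ω Φ ∧ Φ 0 0 ∈ frontier Ω ∧ 0 < c ∧
      ∀ᶠ τ in 𝓝 0, ball (Φ 0 τ) (c * ‖τ‖ ^ 2) ⊆ Ω := by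
  have hline : ∀ᶠ τ : ℂ in 𝓝 0, z + τ • w ∈ Ω :=
    (by fun_prop : Continuous fun τ : ℂ => z + τ • w).continuousAt.eventually_mem
      (hΩ.mem_nhds (by simpa using hz))
  obtain ⟨f, c, hf, hc, hf0, hfd⟩ := h.exists_norm_add_le
    (hline.mono fun τ => (infDist_compl_pos_iff hΩ hne).2)
  rw [zero_smul, add_zero] at hf0
  obtain ⟨Φ, hΦ, hΦ0, hball⟩ :=
    exists_isTouchingFamily_of_norm_add_le_infDist hΩ hne hz hf hc hf0 hfd
  exact ⟨Φ, c, hΦ, hΦ0, hc, hball⟩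

end TouchingDiscs

section Taylor

open Asymptotics

variable {E F : Type*} [NormedAddCommGroup E] [NormedSpace ℝ E] [NormedAddCommGroup F]
  [NormedSpace ℝ F]

theorem isLittleO_sub_taylor_two {f : E → F} {p : E} (hf : ContDiffAt ℝ 2 f p) :
    (fun h => f (p + h) - f p - fderiv ℝ f p h - (1 / 2 : ℝ) • fderiv ℝ (fderiv ℝ f) p h h)
      =o[𝓝 0] fun h => ‖h‖ ^ 2 := by
  set Q := fderiv ℝ (fderiv ℝ f) p
  have hsymm : ∀ x y, Q x y = Q y x := hf.isSymmSndFDerivAt (by simp)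
  have hshift : Tendsto (p + ·) (𝓝 0) (𝓝 p) :=
    (by fun_prop : Continuous (p + ·)).tendsto' _ _ (add_zero p)
  obtain ⟨r, hr, hdiff⟩ := eventually_nhds_iff_ball.1 <| hshift.eventually <|
    (hf.eventually (by simp)).mono fun z hz => hz.differentiableAt two_ne_zero
  have hderiv : ∀ x ∈ ball (0 : E) r,
      HasFDerivWithinAt (fun h => f (p + h) - fderiv ℝ f p h - (1 / 2 : ℝ) • Q h h)
        (fderiv ℝ f (p + x) - fderiv ℝ f p - Q x) (ball 0 r) x := fun x hx => by
    have hfx : HasFDerivAt (fun h => f (p + h)) (fderiv ℝ f (p + x)) x :=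
      (hasFDerivAt_comp_add_left p).2 (hdiff x hx).hasFDerivAt
    have hQ := (Q.hasFDerivAt_of_bilinear (hasFDerivAt_id x) (hasFDerivAt_id x)).const_smul
      (1 / 2 : ℝ)
    refine (((hfx.sub (fderiv ℝ f p).hasFDerivAt).sub hQ).congr_fderiv ?_).hasFDerivWithinAt
    ext y
    simp only [one_div, id_eq, ContinuousLinearMap.precompR_apply, ContinuousLinearMap.compL_apply,
      ContinuousLinearMap.comp_id, smul_add, sub_apply, add_apply, smul_apply,
      ContinuousLinearMap.precompL_apply, ContinuousLinearMap.id_apply, hsymm y x, sub_right_inj]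
    module
  have hQderiv : HasFDerivAt (fderiv ℝ f) Q p :=
    ((hf.fderiv_right (m := 1) (by norm_num)).differentiableAt one_ne_zero).hasFDerivAt
  have hsmall : (fun h => fderiv ℝ f (p + h) - fderiv ℝ f p - Q h)
      =o[𝓝[ball 0 r] 0] fun h => ‖h - 0‖ ^ 1 := by
    simpa using (hasFDerivAt_iff_isLittleO_nhds_zero.1 hQderiv).norm_right.mono
      nhdsWithin_le_nhds
  have h := (convex_ball 0 r).isLittleO_pow_succ (mem_ball_self hr) hderiv hsmall
  rw [isOpen_ball.nhdsWithin_eq (mem_ball_self hr)] at h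
  refine (h.congr_left fun h => ?_).congr_right fun h => by simp
  simp only [add_zero, map_zero, smul_zero, sub_zero]
  abel

theorem isLittleO_quadratic_sub {α : Type*} {l : Filter α} (Q : E →L[ℝ] E →L[ℝ] F) {x y : α → E}
    {g : α → ℝ} (hxy : (fun i => x i - y i) =o[l] g) (hy : y =O[l] g) :
    (fun i => Q (x i) (x i) - Q (y i) (y i)) =o[l] fun i => g i ^ 2 := by
  have hx : x =O[l] g := (hxy.isBigO.add hy).congr_left fun i => sub_add_cancel _ _
  have hleft : (fun i => Q (x i - y i) (x i)) =o[l] fun i => g i * g i :=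
    (Q.isBoundedBilinearMap.isBigO_comp (g := fun i => x i - y i) (h := x)).trans_isLittleO
      (hxy.norm_left.mul_isBigO hx.norm_left)
  have hright : (fun i => Q (y i) (x i - y i)) =o[l] fun i => g i * g i :=
    (Q.isBoundedBilinearMap.isBigO_comp (g := y) (h := fun i => x i - y i)).trans_isLittleO
      (hy.norm_left.mul_isLittleO hxy.norm_left)
  refine ((hleft.add hright).congr_left fun i => ?_).congr_right fun i => (sq _).symm
  simp only [map_sub, sub_apply]
  abel

end Taylor

section LeviForm

open Asymptotics

theorem eq_zero_and_nonpos_of_eventually_re_le {a b : ℂ} {m : ℝ}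
    (h : ∀ ε > 0, ∀ᶠ τ : ℂ in 𝓝 0, (τ * a + τ ^ 2 * b).re + m * ‖τ‖ ^ 2 ≤ ε * ‖τ‖ ^ 2) :
    a = 0 ∧ m ≤ 0 := by
  have ha : a = 0 := by
    have hlim : Tendsto (fun t : ℝ => (t : ℂ) * conj a) (𝓝 0) (𝓝 0) :=
      (by fun_prop : Continuous fun t : ℝ => (t : ℂ) * conj a).tendsto' _ _ (by simp)
    set K := (conj a ^ 2 * b).re + (m - 1) * ‖a‖ ^ 2 with hK
    have hmax : IsLocalMax (fun t : ℝ => ‖a‖ ^ 2 * t + K * t ^ 2) 0 := by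
      filter_upwards [hlim.eventually (h 1 one_pos)] with t ht
      have hlin : (t * conj a * a).re = t * ‖a‖ ^ 2 := by
        rw [mul_assoc, Complex.conj_mul', Complex.re_ofReal_mul, ← Complex.ofReal_pow,
          Complex.ofReal_re]
      have hquad : ((t * conj a) ^ 2 * b).re = t ^ 2 * (conj a ^ 2 * b).re := by
        rw [mul_pow, mul_assoc, ← Complex.ofReal_pow, Complex.re_ofReal_mul]
      rw [Complex.add_re, hlin, hquad, norm_mul, Complex.norm_real, Real.norm_eq_abs, mul_pow,
        sq_abs, Complex.norm_conj] at ht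
      rw [hK]
      linarith
    have hderiv : HasDerivAt (fun t : ℝ => ‖a‖ ^ 2 * t + K * t ^ 2) (‖a‖ ^ 2) 0 :=
      (((hasDerivAt_id (0 : ℝ)).const_mul (‖a‖ ^ 2)).add
        ((hasDerivAt_pow 2 (0 : ℝ)).const_mul K)).congr_deriv (by simp)
    simpa using hmax.hasDerivAt_eq_zero hderiv
  subst ha
  refine ⟨rfl, le_of_forall_pos_le_add fun ε hε => ?_⟩
  have hI : Tendsto (fun τ : ℂ => Complex.I * τ) (𝓝 0) (𝓝 0) :=
    (continuous_const_mul _).tendsto' _ _ (mul_zero _)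
  obtain ⟨τ, ⟨hτ, hIτ⟩, hτ0⟩ := ((((h ε hε).and (hI.eventually (h ε hε))).filter_mono
    nhdsWithin_le_nhds).and (eventually_mem_nhdsWithin (s := {0}ᶜ))).exists
  -- The pluriharmonic term `Re (τ² b)` changes sign under `τ ↦ iτ`.
  have hτ_pos : 0 < ‖τ‖ ^ 2 := pow_pos (norm_pos_iff.2 hτ0) 2
  simp only [mul_zero, zero_add, mul_pow, Complex.I_sq, neg_mul, Complex.neg_re,
    norm_mul, Complex.norm_I, one_mul] at hτ hIτ
  nlinarith

variable {E : Type*} [NormedAddCommGroup E] [NormedSpace ℂ E]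

theorem isLittleO_sq_smul {ψ : ℂ → E} (hψ : ContinuousAt ψ 0) :
    (fun τ : ℂ => τ ^ 2 • ψ τ) =o[𝓝 0] fun τ => ‖τ‖ := by
  have hsq : (fun τ : ℂ => τ ^ 2) =o[𝓝 0] fun τ => ‖τ‖ := by
    simpa only [pow_one] using (isLittleO_pow_pow (𝕜 := ℂ) one_lt_two).norm_right
  simpa only [smul_eq_mul, mul_one] using hsq.smul_isBigO (hψ.isBigO_one ℝ)

theorem isLittleO_re_sq_mul_sub (L : StrongDual ℂ E) {ψ : ℂ → E} (hψ : ContinuousAt ψ 0) :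
    (fun τ : ℂ => (τ ^ 2 * (L (ψ τ) - L (ψ 0))).re) =o[𝓝 0] fun τ => ‖τ‖ ^ 2 := by
  have hL : (fun τ => L (ψ τ) - L (ψ 0)) =o[𝓝 0] fun _ => (1 : ℂ) :=
    (isLittleO_one_iff ℂ).2 (tendsto_sub_nhds_zero_iff.2 (L.continuous.continuousAt.comp hψ))
  have hmul := ((isBigO_refl (fun τ : ℂ => τ ^ 2) (𝓝 0)).mul_isLittleO hL).norm_right
  simp only [mul_one, norm_pow] at hmul
  exact (isBigO_of_le _ fun τ => Complex.abs_re_le_norm _).trans_isLittleO hmul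

variable [NormedSpace ℝ E] [IsScalarTower ℝ ℂ E] {ρ : E → ℝ} {p : E}

/-- The complex differential `2 ∂ρ(p)`: the complex linear form whose real part is the real
differential of `ρ` at `p`. -/
noncomputable def complexDifferential (ρ : E → ℝ) (p : E) : StrongDual ℂ E :=
  StrongDual.extendRCLike (𝕜 := ℂ) (fderiv ℝ ρ p)

/-- The Levi form of `ρ` at `p` in the direction `v`, normalised as the Laplacian at `τ = 0` of
`τ ↦ ρ (p + τ • v)`, which is four times the value of the complex Hessian of `ρ` on `v`. -/
noncomputable def leviForm (ρ : E → ℝ) (p v : E) : ℝ :=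
  fderiv ℝ (fderiv ℝ ρ) p v v +
    fderiv ℝ (fderiv ℝ ρ) p (Complex.I • v) (Complex.I • v)

/-- The Levi form of `ρ` at `p` is negative in some direction of the complex tangent space
`ker ∂ρ(p)` of the level set of `ρ` through `p`, so that the sublevel set is not pseudoconvex
there. -/
def HasNegativeLeviDirection (ρ : E → ℝ) (p : E) : Prop :=
  ∃ v, complexDifferential ρ p v = 0 ∧ leviForm ρ p v < 0

theorem re_complexDifferential_apply (ρ : E → ℝ) (p v : E) :
    (complexDifferential ρ p v).re = fderiv ℝ ρ p v :=
  StrongDual.re_extendRCLike_apply (𝕜 := ℂ) (fderiv ℝ ρ p) v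

theorem exists_complexDifferential_apply_eq_one (h : fderiv ℝ ρ p ≠ 0) :
    ∃ ν, complexDifferential ρ p ν = 1 := by
  obtain ⟨x, hx⟩ := DFunLike.ne_iff.1 h
  have hx' : complexDifferential ρ p x ≠ 0 := fun h0 =>
    hx (by rw [← re_complexDifferential_apply, h0, Complex.zero_re, zero_apply])
  exact ⟨(complexDifferential ρ p x)⁻¹ • x, by rw [map_smul, smul_eq_mul, inv_mul_cancel₀ hx']⟩

theorem exists_half_quadratic_smul_eq (Q : E →L[ℝ] E →L[ℝ] ℝ) (hQ : ∀ x y, Q x y = Q y x) (v : E) :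
    ∃ S : ℂ, ∀ τ : ℂ, 1 / 2 * Q (τ • v) (τ • v) =
      (τ ^ 2 * S).re + (Q v v + Q (Complex.I • v) (Complex.I • v)) / 4 * ‖τ‖ ^ 2 := by
  set w := Complex.I • v with hw
  refine ⟨⟨(Q v v - Q w w) / 4, -Q v w / 2⟩, fun τ => ?_⟩
  have hτ : τ • v = τ.re • v + τ.im • w := by
    rw [hw, RCLike.real_smul_eq_coe_smul (K := ℂ) τ.re, RCLike.real_smul_eq_coe_smul (K := ℂ) τ.im,
      smul_smul, ← add_smul]
    simp [Complex.re_add_im]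
  rw [hτ, Complex.sq_norm, Complex.normSq_apply]
  simp only [map_add, map_smul, add_apply, smul_apply, smul_eq_mul, hQ w v, sq, Complex.mul_re,
    Complex.mul_im]
  ring

theorem exists_isLittleO_sub_levi_expansion (hρ : ContDiffAt ℝ 2 ρ p) (v : E) :
    ∃ S : ℂ, ∀ ψ : ℂ → E, ContinuousAt ψ 0 →
      (fun τ : ℂ => ρ (p + (τ • v + τ ^ 2 • ψ τ)) - ρ p -
        ((τ * complexDifferential ρ p v + τ ^ 2 * (complexDifferential ρ p (ψ 0) + S)).re +
          leviForm ρ p v / 4 * ‖τ‖ ^ 2)) =o[𝓝 0] fun τ => ‖τ‖ ^ 2 := by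
  obtain ⟨S, hS⟩ := exists_half_quadratic_smul_eq (fderiv ℝ (fderiv ℝ ρ) p)
    (hρ.isSymmSndFDerivAt (by simp)) v
  refine ⟨S, fun ψ hψ => ?_⟩
  have hlin : (fun τ : ℂ => τ • v) =O[𝓝 0] fun τ => ‖τ‖ :=
    isBigO_of_le' (c := ‖v‖) _ fun τ => by rw [norm_smul, norm_norm, mul_comm]
  have hdiff : (fun τ : ℂ => τ • v + τ ^ 2 • ψ τ - τ • v) =o[𝓝 0] fun τ => ‖τ‖ := by
    simpa only [add_sub_cancel_left] using isLittleO_sq_smul hψ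
  have hdisc : (fun τ : ℂ => τ • v + τ ^ 2 • ψ τ) =O[𝓝 0] fun τ => ‖τ‖ :=
    (hdiff.isBigO.add hlin).congr_left fun τ => sub_add_cancel _ _
  have htaylor := ((isLittleO_sub_taylor_two hρ).comp_tendsto
    (hdisc.trans_tendsto tendsto_norm_zero)).trans_isBigO (hdisc.norm_left.pow 2)
  have hquad := (isLittleO_quadratic_sub (fderiv ℝ (fderiv ℝ ρ) p) hdiff hlin).const_mul_left
    (1 / 2)
  refine ((htaylor.add hquad).add
    (isLittleO_re_sq_mul_sub (complexDifferential ρ p) hψ)).congr_left fun τ => ?_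
  simp only [Function.comp_apply, ← re_complexDifferential_apply ρ p, map_add, map_smul,
    smul_eq_mul, mul_sub, mul_add, hS, leviForm, Complex.add_re, Complex.sub_re]
  ring

theorem hasNegativeLeviDirection_of_eventually_le [CompleteSpace E] (hρ : ContDiffAt ℝ 2 ρ p)
    (hp : ρ p = 0) {φ : ℂ → E} (hφ : Differentiable ℂ φ) (hφp : φ 0 = p) {c : ℝ} (hc : 0 < c)
    (hle : ∀ᶠ τ in 𝓝 0, ρ (φ τ) ≤ -c * ‖τ‖ ^ 2) : HasNegativeLeviDirection ρ p := by
  obtain ⟨ψ, hψ, hφψ⟩ := exists_entire_quadratic_expansion hφ 0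
  obtain ⟨S, hS⟩ := exists_isLittleO_sub_levi_expansion hρ (deriv φ 0)
  obtain ⟨htangent, hlevi⟩ := eq_zero_and_nonpos_of_eventually_re_le
    (a := complexDifferential ρ p (deriv φ 0)) (b := complexDifferential ρ p (ψ 0) + S)
    (m := leviForm ρ p (deriv φ 0) / 4 + c) fun ε hε => by
      filter_upwards [(hS ψ hψ.continuous.continuousAt).bound hε, hle] with τ hτ hτle
      rw [hp, ← hφp, ← add_assoc, ← hφψ, zero_add, norm_pow, norm_norm, Real.norm_eq_abs,
        hφp] at hτ
      linarith [neg_le_of_abs_le hτ]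
  exact ⟨deriv φ 0, htangent, by linarith⟩

theorem HasNegativeLeviDirection.exists_eventually_le (h : HasNegativeLeviDirection ρ p)
    (hρ : ContDiffAt ℝ 2 ρ p) (hdρ : fderiv ℝ ρ p ≠ 0) (hp : ρ p = 0) :
    ∃ (v b : E) (c : ℝ), 0 < c ∧
      ∀ᶠ τ : ℂ in 𝓝 0, ρ (p + (τ • v + τ ^ 2 • b)) ≤ -c * ‖τ‖ ^ 2 := by
  obtain ⟨v, hv, hlevi⟩ := h
  obtain ⟨ν, hν⟩ := exists_complexDifferential_apply_eq_one hdρ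
  obtain ⟨S, hS⟩ := exists_isLittleO_sub_levi_expansion hρ v
  refine ⟨v, -S • ν, -leviForm ρ p v / 8, by linarith, ?_⟩
  -- The second order term of the disc cancels the pluriharmonic part of the Hessian.
  filter_upwards [(hS (fun _ => -S • ν) continuousAt_const).bound
    (c := -leviForm ρ p v / 8) (by linarith)] with τ hτ
  rw [hp, hv, map_smul, hν, norm_pow, norm_norm, Real.norm_eq_abs] at hτ
  simp only [mul_zero, smul_eq_mul, mul_one, neg_add_cancel, add_zero, Complex.zero_re, zero_add,
    sub_zero] at hτ
  linarith [le_of_abs_le hτ]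

theorem HasNegativeLeviDirection.eventually (h : HasNegativeLeviDirection ρ p)
    (hρ : ContDiffAt ℝ 2 ρ p) (hdρ : fderiv ℝ ρ p ≠ 0) :
    ∀ᶠ q in 𝓝 p, HasNegativeLeviDirection ρ q := by
  obtain ⟨v, hv, hlevi⟩ := h
  obtain ⟨ν, hν⟩ := exists_complexDifferential_apply_eq_one hdρ
  have hC1 : ContDiffAt ℝ 1 (fderiv ℝ ρ) p := hρ.fderiv_right (by norm_num)
  have hD := hC1.continuousAt
  have hD2 : ContinuousAt (fderiv ℝ (fderiv ℝ ρ)) p :=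
    (hC1.fderiv_right (m := 0) le_rfl).continuousAt
  have hL : ∀ x, ContinuousAt (fun q => complexDifferential ρ q x) p := fun x => by
    simp only [complexDifferential, StrongDual.extendRCLike_apply]
    fun_prop
  -- Project `v` along `ν` onto the complex tangent space at `q`.
  let V : E → E := fun q =>
    v - (complexDifferential ρ q v / complexDifferential ρ q ν) • ν
  have hV : ContinuousAt V p :=
    continuousAt_const.sub (((hL v).div (hL ν) (by simp [hν])).smul continuousAt_const)
  have hleviV : ContinuousAt (fun q => leviForm ρ q (V q)) p := by
    unfold leviForm
    fun_prop
  have hneg : leviForm ρ p (V p) < 0 := by simpa [V, hv] using hlevi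
  filter_upwards [hleviV.eventually_lt_const hneg,
    (hL ν).eventually_ne (by rw [hν]; exact one_ne_zero)] with q hq hνq
  exact ⟨V q, by simp [V, hνq], hq⟩

end LeviForm

section DefiningFunction

theorem eventually_add_half_le {E : Type*} [NormedAddCommGroup E] [NormedSpace ℝ E] {ρ : E → ℝ}
    {ℓ : StrongDual ℝ E} {p ν : E} (hρ : HasStrictFDerivAt ρ ℓ p) (hν : ℓ ν = 1) :
    ∀ᶠ x : E × ℝ in 𝓝 (p, 0), 0 ≤ x.2 → ρ x.1 + x.2 / 2 ≤ ρ (x.1 + x.2 • ν) := by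
  have hν_pos : 0 < ‖ν‖ := norm_pos_iff.2 fun h => by simp [h] at hν
  have hlim : Tendsto (fun x : E × ℝ => (x.1 + x.2 • ν, x.1)) (𝓝 (p, 0)) (𝓝 (p, p)) :=
    (by fun_prop : Continuous fun x : E × ℝ => (x.1 + x.2 • ν, x.1)).tendsto' _ _ (by simp)
  filter_upwards [hlim.eventually (hρ.isLittleO.bound (c := 1 / (2 * ‖ν‖)) (by positivity))]
    with ⟨x, t⟩ hx ht
  rw [add_sub_cancel_left, map_smul, hν, norm_smul, Real.norm_of_nonneg ht, Real.norm_eq_abs,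
    smul_eq_mul, mul_one] at hx
  have hbound : 1 / (2 * ‖ν‖) * (t * ‖ν‖) = t / 2 := by field_simp
  linarith [neg_le_of_abs_le hx]

/-- `ρ` is a `C²` defining function with nonvanishing differential for `Ω` in a neighbourhood of
`p`. -/
structure IsC2DefiningAt {E : Type*} [NormedAddCommGroup E] [NormedSpace ℝ E] (Ω : Set E)
    (ρ : E → ℝ) (p : E) : Prop where
  contDiffAt : ContDiffAt ℝ 2 ρ p
  fderiv_ne_zero : fderiv ℝ ρ p ≠ 0
  eventually_mem_iff : ∀ᶠ z in 𝓝 p, z ∈ Ω ↔ ρ z < 0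

theorem HasC2BoundaryNear.exists_isC2DefiningAt {n : ℕ} {Ω : Set (EuclideanSpace ℂ (Fin n))}
    {a : EuclideanSpace ℂ (Fin n)} (h : HasC2BoundaryNear Ω a) :
    ∃ ρ, ∀ᶠ q in 𝓝 a, IsC2DefiningAt Ω ρ q := by
  obtain ⟨U, ρ, hU, haU, hρ, hdρ, hΩU⟩ := h
  refine ⟨ρ, ?_⟩
  filter_upwards [hU.mem_nhds haU] with q hq
  refine ⟨hρ.contDiffAt (hU.mem_nhds hq), hdρ q hq, ?_⟩
  filter_upwards [hU.mem_nhds hq] with z hz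
  simpa [hz] using Set.ext_iff.1 hΩU z

namespace IsC2DefiningAt

variable {E : Type*} [NormedAddCommGroup E] [NormedSpace ℝ E] {Ω : Set E} {ρ : E → ℝ} {p : E}

theorem eq_zero_of_mem_frontier (h : IsC2DefiningAt Ω ρ p) (hp : p ∈ frontier Ω) : ρ p = 0 := by
  have hcont : Tendsto ρ (𝓝 p) (𝓝 (ρ p)) := h.contDiffAt.continuousAt
  rw [frontier_eq_closure_inter_closure, mem_inter_iff, mem_closure_iff_frequently,
    mem_closure_iff_frequently] at hp
  exact le_antisymm
    (le_of_tendsto_of_frequently hcont ((hp.1.and_eventually h.eventually_mem_iff).mono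
      fun z hz => (hz.2.1 hz.1).le))
    (ge_of_tendsto_of_frequently hcont ((hp.2.and_eventually h.eventually_mem_iff).mono
      fun z hz => not_lt.1 fun hlt => hz.1 (hz.2.2 hlt)))

theorem exists_eventually_add_half_le (h : IsC2DefiningAt Ω ρ p) :
    ∃ ν : E, ∀ᶠ x : E × ℝ in 𝓝 (p, 0), 0 ≤ x.2 → ρ x.1 + x.2 / 2 ≤ ρ (x.1 + x.2 • ν) := by
  obtain ⟨x, hx⟩ := DFunLike.ne_iff.1 h.fderiv_ne_zero
  exact ⟨(fderiv ℝ ρ p x)⁻¹ • x, eventually_add_half_le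
    (h.contDiffAt.hasStrictFDerivAt two_ne_zero)
    (by rw [map_smul, smul_eq_mul, inv_mul_cancel₀ hx])⟩

variable [NormedSpace ℂ E] [IsScalarTower ℝ ℂ E]

theorem hasNegativeLeviDirection_of_ball_subset [CompleteSpace E] (h : IsC2DefiningAt Ω ρ p)
    (hp : p ∈ frontier Ω) {φ : ℂ → E} (hφ : Differentiable ℂ φ) (hφp : φ 0 = p) {c : ℝ}
    (hc : 0 < c) (hball : ∀ᶠ τ in 𝓝 0, ball (φ τ) (c * ‖τ‖ ^ 2) ⊆ Ω) :
    HasNegativeLeviDirection ρ p := by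
  obtain ⟨ν, hν⟩ := h.exists_eventually_add_half_le
  -- Points of the disc can be moved by `s τ` along `ν` without leaving `Ω`.
  set k := c / (‖ν‖ + 1) with hk
  have hk_pos : 0 < k := by positivity
  have hkν : k * ‖ν‖ < c := by
    rw [hk, div_mul_eq_mul_div, div_lt_iff₀ (by positivity)]
    linarith
  let s : ℂ → ℝ := fun τ => k * ‖τ‖ ^ 2
  have hs : Continuous s := by fun_prop
  have hφ_cont := hφ.continuous
  have hlim : Tendsto (fun τ => (φ τ, s τ)) (𝓝 0) (𝓝 (p, 0)) :=
    (hφ_cont.prodMk hs).tendsto' _ _ (by simp [s, hφp])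
  have hlim' : Tendsto (fun τ => φ τ + s τ • ν) (𝓝 0) (𝓝 p) :=
    (hφ_cont.add (hs.smul continuous_const)).tendsto' _ _ (by simp [s, hφp])
  have hρp := h.eq_zero_of_mem_frontier hp
  refine hasNegativeLeviDirection_of_eventually_le h.contDiffAt hρp hφ hφp (half_pos hk_pos) ?_
  filter_upwards [hlim.eventually hν, hlim'.eventually h.eventually_mem_iff, hball]
    with τ hτν hτΩ hτball
  rcases eq_or_ne τ 0 with rfl | hτ
  · simp [hφp, hρp]
  · have : 0 < ‖τ‖ ^ 2 := pow_pos (norm_pos_iff.2 hτ) 2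
    have hs_nonneg : 0 ≤ s τ := by positivity
    have hmoved : φ τ + s τ • ν ∈ Ω := hτball <| by
      rw [mem_ball_iff_norm, add_sub_cancel_left, norm_smul, Real.norm_of_nonneg hs_nonneg,
        mul_right_comm]
      gcongr
    have hgrowth := hτν hs_nonneg
    have hneg := hτΩ.1 hmoved
    simp only [s] at hgrowth hneg
    linarith

theorem exists_isTouchingFamily (h : IsC2DefiningAt Ω ρ p) (hp : p ∈ frontier Ω)
    (hneg : HasNegativeLeviDirection ρ p) :
    ∃ Φ : ℝ → ℂ → E, IsTouchingFamily Ω Φ ∧ Φ 0 0 = p := by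
  obtain ⟨ν, hν⟩ := h.exists_eventually_add_half_le
  obtain ⟨v, b, c, hc, hdisc⟩ := hneg.exists_eventually_le h.contDiffAt h.fderiv_ne_zero
    (h.eq_zero_of_mem_frontier hp)
  let Φ : ℝ → ℂ → E := fun t τ => p + (τ • v + τ ^ 2 • b) - t • ν
  have hΦ : Continuous fun x : ℝ × ℂ => Φ x.1 x.2 := by fun_prop
  have hΦ0 : Φ 0 0 = p := by simp [Φ]
  have hlim : Tendsto (fun x : ℝ × ℂ => Φ x.1 x.2) (𝓝 0) (𝓝 p) := hΦ.tendsto' _ _ hΦ0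
  have hlim' : Tendsto (fun x : ℝ × ℂ => (Φ x.1 x.2, x.1)) (𝓝 0) (𝓝 (p, 0)) :=
    (hΦ.prodMk continuous_fst).tendsto' _ _ (by simp [hΦ0])
  have hsnd : Tendsto (Prod.snd : ℝ × ℂ → ℂ) (𝓝 0) (𝓝 0) := continuous_snd.tendsto 0
  refine ⟨Φ, ⟨hΦ, fun t => by fun_prop, eventually_nhdsWithin_iff.2 ?_⟩, hΦ0⟩
  filter_upwards [hlim.eventually h.eventually_mem_iff, hlim'.eventually hν, hsnd.eventually hdisc]
    with ⟨t, τ⟩ hΩ hgrowth hdisc hne ht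
  have hbound : ρ (Φ t τ) + t / 2 ≤ -c * ‖τ‖ ^ 2 :=
    (hgrowth ht).trans (by simpa only [Φ, sub_add_cancel] using hdisc)
  refine hΩ.2 (?_ : ρ (Φ t τ) < 0)
  rcases eq_or_ne τ 0 with rfl | hτ
  · have ht_pos : 0 < t := lt_of_le_of_ne ht fun h => hne (by simp [← h])
    rw [norm_zero] at hbound
    linarith
  · have : 0 < c * ‖τ‖ ^ 2 := mul_pos hc (pow_pos (norm_pos_iff.2 hτ) 2)
    linarith

end IsC2DefiningAt

theorem HasC2BoundaryNear.eventually_not_locallyPseudoconvexAt {n : ℕ}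
    {Ω : Set (EuclideanSpace ℂ (Fin n))} {p : EuclideanSpace ℂ (Fin n)}
    (h : HasC2BoundaryNear Ω p) (hΩ : IsOpen Ω) (hp : p ∈ frontier Ω)
    {φ : ℂ → EuclideanSpace ℂ (Fin n)} (hφ : Differentiable ℂ φ) (hφp : φ 0 = p) {c : ℝ}
    (hc : 0 < c) (hball : ∀ᶠ τ in 𝓝 0, ball (φ τ) (c * ‖τ‖ ^ 2) ⊆ Ω) :
    ∀ᶠ q in 𝓝 p, q ∈ frontier Ω → ¬ LocallyPseudoconvexAt Ω q := by
  obtain ⟨ρ, hρ⟩ := h.exists_isC2DefiningAt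
  have hρp := hρ.self_of_nhds
  have hneg := hρp.hasNegativeLeviDirection_of_ball_subset hp hφ hφp hc hball
  filter_upwards [hρ, hneg.eventually hρp.contDiffAt hρp.fderiv_ne_zero] with q hρq hnegq hq
  obtain ⟨Φ, hΦ, rfl⟩ := hρq.exists_isTouchingFamily hq hnegq
  exact hΦ.not_locallyPseudoconvexAt hΩ hq

end DefiningFunction

theorem proposition2p1_general (n : ℕ) (Ω F : Set (EuclideanSpace ℂ (Fin n)))
    (hΩ : IsOpen Ω)
    (hC2 : ∀ a ∈ F, HasC2BoundaryNear Ω a)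
    (hloc : ∀ ζ ∈ frontier Ω \ F, LocallyPseudoconvexAt Ω ζ)
    (hint : interior (Subtype.val ⁻¹' F : Set (frontier Ω)) = ∅) :
    IsPseudoconvex Ω := by
  by_contra hnot
  obtain ⟨hne, z, hz, w, htouched⟩ := exists_isStrictlyTouched_of_not_isPseudoconvex hΩ hnot
  obtain ⟨Φ, c, hΦ, hp, hc, hball⟩ :=
    exists_isTouchingFamily_of_isStrictlyTouched hΩ hne hz htouched
  by_cases hpF : Φ 0 0 ∈ F
  · have hnear := (hC2 _ hpF).eventually_not_locallyPseudoconvexAt hΩ hp (hΦ.differentiable 0) rfl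
      hc hball
    have hF : Subtype.val ⁻¹' F ∈ 𝓝 (⟨Φ 0 0, hp⟩ : frontier Ω) := by
      filter_upwards [continuousAt_subtype_val.eventually hnear] with q hq
      exact by_contra fun hqF => hq q.2 (hloc q ⟨q.2, hqF⟩)
    exact notMem_empty _ (hint ▸ mem_interior_iff_mem_nhds.2 hF)
  · exact hΦ.not_locallyPseudoconvexAt hΩ hp (hloc _ ⟨hp, hpF⟩)

theorem proposition2p1 (n : ℕ) (Ω F : Set (EuclideanSpace ℂ (Fin n)))
    (hΩ : IsOpen Ω)
    (hF : IsClosed F) (hFΩ : F ⊆ frontier Ω)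
    (hC2 : ∀ a ∈ F, HasC2BoundaryNear Ω a)
    (hloc : ∀ ζ ∈ frontier Ω \ F, LocallyPseudoconvexAt Ω ζ)
    (hint : interior (Subtype.val ⁻¹' F : Set (frontier Ω)) = ∅) :
    IsPseudoconvex Ω :=
  proposition2p1_general n Ω F hΩ hC2 hloc hint
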